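/- Let $f(x,y)=x^3(y^2+y+1)-y(y^2-2y+4)\in\mathbb{Z}[x,y]$. Put $R^{(1)}(x,x_1)=f(x,x_1)$ and, inductively for $n\ge 2$, $$R^{(n)}(x,x_n)=\operatorname{Res}_{x_{n-1}}\bigl(R^{(n-1)}(x,x_{n-1}),\,f(x_{n-1},x_n)\bigr),$$ and let $R_n(x)=R^{(n)}(x,x)\in\mathbb{Z}[x]$ for $n\ge 1$. Then for every $n\ge 1$: (a) the polynomial $R_n(x)$ is nonzero and has distinct roots (in $\mathbb{C}$); (b) the expression $$P_n(x)=\prod_{k\mid n}R_k(x)^{\mu(n/k)},$$ a priori an element of the field of fractions of $\mathbb{Z}[x]$, is a nonzero polynomial in $\mathbb{Z}[x]$ with distinct roots (in $\mathbb{C}$), and for $n\ge 2$ its degree is $$\deg P_n(x)=2\sum_{k\mid n}\mu(n/k)\,3^k;$$ (c) $R_n(x)\equiv(-1)^{n-1}(x^{3^n}-x)(x-1)^{3^n-1}\pmod 3$; (d) $\deg R_n(x)=2\cdot 3^n-1$. -/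

import Mathlib

open Polynomial

noncomputable section

/-- The value `f(a, b) = a³(b² + b + 1) - b(b² - 2b + 4)` in a commutative ring. -/
def fPoly {A : Type*} [CommRing A] (a b : A) : A :=
  a ^ 3 * (b ^ 2 + b + 1) - b * (b ^ 2 - 2 * b + 4)

/-- The iterated resultants `R⁽ⁿ⁾(x, y)`, `n ≥ 1`, as elements of `ℤ[x][y]`: the inner variable is
`x` and the outer variable is `y`. The resultant with respect to the intermediate variable `t` is
computed in `ℤ[x][y][t]`: there `x` is `C (C X)`, `y` is `C X` and `t` is `X`, so that
`(iterRes (n + 1)).map C` is `R⁽ⁿ⁺¹⁾(x, t)` and `fPoly X (C X)` is `f(t, y)`.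
The value at `0` is a placeholder. -/
def iterRes : ℕ → ℤ[X][X]
  | 0 => 0
  | 1 => fPoly (C X) X
  | n + 2 => resultant ((iterRes (n + 1)).map (C : ℤ[X] →+* ℤ[X][X]))
      (fPoly X (C X) : ℤ[X][X][X])

/-- `R_n(x) = R⁽ⁿ⁾(x, x)`. -/
def Rpoly (n : ℕ) : ℤ[X] := (iterRes n).eval X

/-- The expression `P_n(x) = ∏_{k ∣ n} R_k(x) ^ μ(n / k)`, an element of the field of fractions
of `ℤ[x]`. -/
def Pfrac (n : ℕ) : FractionRing ℤ[X] :=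
  ∏ k ∈ n.divisors,
    (algebraMap ℤ[X] (FractionRing ℤ[X]) (Rpoly k)) ^ (ArithmeticFunction.moebius (n / k))

/-- A nonzero integer polynomial all of whose complex roots are simple. -/
def HasDistinctRoots (p : ℤ[X]) : Prop :=
  p ≠ 0 ∧ (p.aroots ℂ).Nodup

end

/-! Read `f` as a correspondence sending `a` to the three roots `b` of `f(a, b) = 0`. Over an
algebraically closed field, `R⁽ⁿ⁾(a, y)` is up to sign the product of `y - s` over the `3ⁿ`
endpoints `s` of `n`-step chains from `a` (`iterRes_map_eq_prod`), so the roots of `R_n` are the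
points that can return to themselves in `n` steps.

Degree: near infinity one image of `a` has size `|a|³` and the other two stay bounded, whence
`|R_n(x)| = |x| ^ (3ⁿ + (3ⁿ - 1))` (`valuation_map_Rpoly`). This holds over every field, so no prime
divides the leading coefficient, and all roots are algebraic integers.

Distinctness: modulo 3, `f` becomes `(x³ - y)(y - 1)²`. Modulo a maximal ideal containing 3, the `3ⁿ
- 1` roots of `R_n` with residue other than 1 therefore have distinct residues. The involution `(a -
1)(a' - 1) = 3` carries them to as many roots with residue 1, and the root 1 itself completes the
degree (`algIntRoots_nodup_and_cases`).

Periods: the orbit of the residue under Frobenius gives each root a period `d`, with `R_n` vanishing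
there exactly when `d ∣ n` (`exists_period`). So `R_n` factors according to period, and Möbius
inversion identifies the factor of exact period `n` with `P_n` (`exists_Pfrac_eq`). -/

/-! ### Iterated resultants as products over branches. -/

theorem map_fPoly {A B : Type*} [CommRing A] [CommRing B] (φ : A →+* B) (a b : A) :
    φ (fPoly a b) = fPoly (φ a) (φ b) := by
  simp only [fPoly, map_sub, map_add, map_mul, map_pow, map_one, map_ofNat]

/-- `f(a, y) = -(y³ - (a³ + 2) y² - (a³ - 4) y - a³)`. -/
theorem fPoly_C_X {A : Type*} [CommRing A] (a : A) :
    fPoly (C a) X = C (-1) * X ^ 3 + C (a ^ 3 + 2) * X ^ 2 + C (a ^ 3 - 4) * X + C (a ^ 3) := by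
  simp only [fPoly, map_sub, map_add, map_pow, map_neg, map_one, map_ofNat]
  ring

theorem natDegree_fPoly_C_X {A : Type*} [CommRing A] [Nontrivial A] (a : A) :
    (fPoly (C a) X).natDegree = 3 := by
  rw [fPoly_C_X]
  exact natDegree_cubic (by simp)

theorem leadingCoeff_fPoly_C_X {A : Type*} [CommRing A] [Nontrivial A] (a : A) :
    (fPoly (C a) X).leadingCoeff = -1 := by
  rw [fPoly_C_X]
  exact leadingCoeff_cubic (by simp)

theorem fPoly_X_C {A : Type*} [CommRing A] (b : A) :
    fPoly X (C b) = C (b ^ 2 + b + 1) * X ^ 3 + C 0 * X ^ 2 + C 0 * X +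
      C (-(b * (b ^ 2 - 2 * b + 4))) := by
  simp only [fPoly, map_sub, map_add, map_mul, map_pow, map_neg, map_one, map_ofNat, map_zero]
  ring

theorem natDegree_fPoly_X_C_X {A : Type*} [CommRing A] [Nontrivial A] :
    (fPoly X (C X) : A[X][X]).natDegree = 3 := by
  rw [fPoly_X_C]
  refine natDegree_cubic fun h => ?_
  have := congrArg (fun p : A[X] => p.coeff 0) h
  simp at this

/-- One step of the iteration, for a polynomial that is a product of linear factors. -/
theorem resultant_fPoly_of_eq_prod {A : Type*} [CommRing A] [IsDomain A] {F : A[X]} {c : A}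
    (hc : c ≠ 0) (T : Multiset A) (hF : F = C c * (T.map fun s => X - C s).prod) :
    resultant (F.map (C : A →+* A[X])) (fPoly X (C X)) F.natDegree 3 =
      C (c ^ 3) * (T.map fun s => fPoly (C s) X).prod := by
  have h1 : F.map (C : A →+* A[X]) = C (C c) * ((T.map C).map fun s => X - C s).prod := by
    rw [hF, Polynomial.map_mul, map_C, Polynomial.map_multiset_prod, Multiset.map_map,
      Multiset.map_map]
    simp
  have hcc : (C c : A[X]) ≠ 0 := by simpa using hc
  have hs : (F.map (C : A →+* A[X])).Splits := by
    rw [h1]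
    refine (Splits.C _).mul (Splits.multisetProd ?_)
    intro f hf
    obtain ⟨s, -, rfl⟩ := Multiset.mem_map.1 hf
    exact Splits.X_sub_C _
  have hr : (F.map (C : A →+* A[X])).roots = T.map C := by
    rw [h1, roots_C_mul _ hcc, roots_multiset_prod_X_sub_C]
  have hl : (F.map (C : A →+* A[X])).leadingCoeff = C c := by
    rw [h1, leadingCoeff_mul, leadingCoeff_C, (monic_multiset_prod_of_monic _ _
      fun s _ => monic_X_sub_C s).leadingCoeff, mul_one]
  have hd : (F.map (C : A →+* A[X])).natDegree = F.natDegree :=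
    natDegree_map_eq_of_injective C_injective F
  have := resultant_eq_prod_eval (F.map (C : A →+* A[X])) (fPoly X (C X)) 3
    natDegree_fPoly_X_C_X.le hs
  rw [hd] at this
  rw [this, hl, hr, Multiset.map_map, C_pow]
  congr 2
  refine Multiset.map_congr rfl fun s _ => ?_
  simp [fPoly]

/-- Resultants commute with ring homomorphisms only for fixed formal degrees, so `hd` asks that `φ`
preserve the degree. -/
theorem iterRes_succ_succ_map {A : Type*} [CommRing A] [IsDomain A] (φ : ℤ[X] →+* A) (n : ℕ)
    (hd : ((iterRes (n + 1)).map φ).natDegree = (iterRes (n + 1)).natDegree)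
    {c : A} (hc : c ≠ 0) (T : Multiset A)
    (hF : (iterRes (n + 1)).map φ = C c * (T.map fun s => X - C s).prod) :
    (iterRes (n + 2)).map φ = C (c ^ 3) * (T.map fun s => fPoly (C s) X).prod := by
  rw [← resultant_fPoly_of_eq_prod hc T hF, hd, iterRes, natDegree_fPoly_X_C_X,
    natDegree_map_eq_of_injective C_injective]
  have := resultant_map_map ((iterRes (n + 1)).map (C : ℤ[X] →+* ℤ[X][X]))
    (fPoly X (C X) : ℤ[X][X][X]) (iterRes (n + 1)).natDegree 3 (mapRingHom φ)
  rw [coe_mapRingHom] at this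
  rw [← this]
  congr 1
  · rw [Polynomial.map_map, Polynomial.map_map]
    congr 1
    ext <;> simp
  · rw [← coe_mapRingHom, map_fPoly]
    simp

theorem iterRes_one_map {A : Type*} [CommRing A] (φ : ℤ[X] →+* A) :
    (iterRes 1).map φ = fPoly (C (φ X)) X := by
  rw [iterRes, ← coe_mapRingHom, map_fPoly]
  simp

theorem natDegree_leadingCoeff_multiset_prod_fPoly {A : Type*} [CommRing A] [IsDomain A]
    (T : Multiset A) :
    (T.map fun s => fPoly (C s) X).prod.natDegree = 3 * T.card ∧
      (T.map fun s => fPoly (C s) X).prod.leadingCoeff = (-1) ^ T.card := by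
  induction T using Multiset.induction_on with
  | empty => simp
  | cons a T ih =>
    have h1 : fPoly (C a) X ≠ 0 := fun h => by
      simpa [h] using natDegree_fPoly_C_X a
    have h2 : (T.map fun s => fPoly (C s) X).prod ≠ 0 := fun h => by
      have := ih.2
      rw [h, leadingCoeff_zero] at this
      exact pow_ne_zero _ (by simp) this.symm
    rw [Multiset.map_cons, Multiset.prod_cons, natDegree_mul h1 h2, leadingCoeff_mul, ih.1, ih.2,
      natDegree_fPoly_C_X, leadingCoeff_fPoly_C_X, Multiset.card_cons]
    constructor <;> ring

theorem eq_C_mul_prod_roots {K : Type*} [Field K] [IsAlgClosed K] (F : K[X]) :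
    F = C F.leadingCoeff * (F.roots.map fun s => X - C s).prod :=
  (IsAlgClosed.splits F).eq_prod_roots

theorem neg_one_pow_three_pow {A : Type*} [CommRing A] (n : ℕ) : (-1 : A) ^ 3 ^ n = -1 :=
  Odd.neg_one_pow (Odd.pow (by decide))

theorem neg_one_pow_pow_three {A : Type*} [CommRing A] (n : ℕ) :
    ((-1 : A) ^ n) ^ 3 = (-1) ^ n := by
  rw [pow_right_comm]
  norm_num

theorem iterRes_natDegree_leadingCoeff (n : ℕ) :
    (iterRes (n + 1)).natDegree = 3 ^ (n + 1) ∧ (iterRes (n + 1)).leadingCoeff = (-1) ^ (n + 1) := by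
  induction n with
  | zero =>
    rw [iterRes, natDegree_fPoly_C_X, leadingCoeff_fPoly_C_X]
    simp
  | succ n ih =>
    -- The generic point: `φ` is injective, so degree and leading coefficient can be read off over
    -- `K`, where everything splits.
    let K := AlgebraicClosure (FractionRing ℤ[X])
    let φ : ℤ[X] →+* K := (algebraMap (FractionRing ℤ[X]) K).comp (algebraMap _ _)
    have hφ : Function.Injective φ :=
      (algebraMap (FractionRing ℤ[X]) K).injective.comp (IsFractionRing.injective _ _)
    have hd := natDegree_map_eq_of_injective hφ (iterRes (n + 1))
    have hl := leadingCoeff_map_of_injective hφ (iterRes (n + 1))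
    have hF := eq_C_mul_prod_roots ((iterRes (n + 1)).map φ)
    rw [hl, ih.2] at hF
    have hcard : ((iterRes (n + 1)).map φ).roots.card = 3 ^ (n + 1) := by
      rw [← ih.1, ← hd]
      exact (IsAlgClosed.splits _).natDegree_eq_card_roots.symm
    have h := iterRes_succ_succ_map φ n hd (by simp) _ hF
    have h2 := natDegree_leadingCoeff_multiset_prod_fPoly ((iterRes (n + 1)).map φ).roots
    rw [hcard, neg_one_pow_three_pow] at h2
    constructor
    · rw [← natDegree_map_eq_of_injective hφ, h, natDegree_C_mul (by simp), h2.1]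
      ring
    · apply hφ
      rw [← leadingCoeff_map_of_injective hφ, h, leadingCoeff_mul, leadingCoeff_C, h2.2]
      simp only [map_pow, map_neg, map_one, neg_one_pow_pow_three]
      ring

/-- The leading coefficient in `y` is `±1`, so it survives every specialisation. -/
theorem natDegree_iterRes_map {A : Type*} [CommRing A] [Nontrivial A] (φ : ℤ[X] →+* A) (n : ℕ) :
    ((iterRes (n + 1)).map φ).natDegree = (iterRes (n + 1)).natDegree := by
  refine natDegree_map_of_leadingCoeff_ne_zero φ ?_
  rw [(iterRes_natDegree_leadingCoeff n).2, map_pow, map_neg, map_one]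
  exact (isUnit_one.neg.pow _).ne_zero

/-- The multiset of values at `a` of the `n`-th iterate of the correspondence `f(x, y) = 0`. -/
noncomputable def iterImages {K : Type*} [Field K] (a : K) : ℕ → Multiset K
  | 0 => {a}
  | n + 1 => (iterImages a n).bind fun s => (fPoly (C s) X).roots

theorem prod_roots_fPoly {K : Type*} [Field K] [IsAlgClosed K] (a : K) :
    fPoly (C a) X = C (-1) * ((fPoly (C a) X).roots.map fun s => X - C s).prod := by
  conv_lhs => rw [eq_C_mul_prod_roots (fPoly (C a) X), leadingCoeff_fPoly_C_X]

theorem card_roots_fPoly {K : Type*} [Field K] [IsAlgClosed K] (a : K) :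
    (fPoly (C a) X).roots.card = 3 := by
  rw [← (IsAlgClosed.splits _).natDegree_eq_card_roots, natDegree_fPoly_C_X]

theorem card_iterImages {K : Type*} [Field K] [IsAlgClosed K] (a : K) (n : ℕ) :
    (iterImages a n).card = 3 ^ n := by
  induction n with
  | zero => simp [iterImages]
  | succ n ih =>
    rw [iterImages, Multiset.card_bind]
    simp [card_roots_fPoly, ih, pow_succ]

theorem iterRes_map_eq_prod {K : Type*} [Field K] [IsAlgClosed K] (φ : ℤ[X] →+* K) (n : ℕ) :
    (iterRes (n + 1)).map φ =
      C ((-1) ^ (n + 1)) * ((iterImages (φ X) (n + 1)).map fun s => X - C s).prod := by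
  induction n with
  | zero =>
    rw [iterRes_one_map, prod_roots_fPoly]
    simp [iterImages]
  | succ n ih =>
    rw [iterRes_succ_succ_map φ n (natDegree_iterRes_map φ n) (by simp) _ ih,
      iterImages.eq_2 _ (n + 1), Multiset.map_bind, Multiset.prod_bind]
    rw [Multiset.map_congr rfl fun s _ => prod_roots_fPoly s, Multiset.prod_map_mul,
      Multiset.map_const', Multiset.prod_replicate, card_iterImages, ← mul_assoc, ← C_pow,
      neg_one_pow_three_pow, ← C_mul,
      neg_one_pow_pow_three, ← pow_succ]

theorem map_Rpoly {A : Type*} [CommRing A] (φ : ℤ[X] →+* A) (n : ℕ) :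
    φ (Rpoly n) = ((iterRes n).map φ).eval (φ X) := by
  rw [Rpoly, eval_map, ← eval₂_id, hom_eval₂, RingHom.comp_id]

theorem map_Rpoly_eq_prod {K : Type*} [Field K] [IsAlgClosed K] (φ : ℤ[X] →+* K) (n : ℕ) :
    φ (Rpoly (n + 1)) =
      (-1) ^ (n + 1) * ((iterImages (φ X) (n + 1)).map fun s => φ X - s).prod := by
  rw [map_Rpoly, iterRes_map_eq_prod, eval_mul, eval_C, eval_multiset_prod, Multiset.map_map]
  simp

theorem map_Rpoly_eq_zero_iff {K : Type*} [Field K] [IsAlgClosed K] (φ : ℤ[X] →+* K) (n : ℕ) :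
    φ (Rpoly (n + 1)) = 0 ↔ φ X ∈ iterImages (φ X) (n + 1) := by
  rw [map_Rpoly_eq_prod, mul_eq_zero, or_iff_right (by simp), Multiset.prod_eq_zero_iff,
    Multiset.mem_map]
  simp [sub_eq_zero]

/-! ### Reduction modulo 3. -/

theorem fPoly_char_three {A : Type*} [CommRing A] [CharP A 3] (a b : A) :
    fPoly a b = (a ^ 3 - b) * (b - 1) ^ 2 := by
  have h3 : (3 : A) = 0 := by simpa using CharP.cast_eq_zero A 3
  simp only [fPoly]
  linear_combination (a ^ 3 * b - b) * h3

/-- In characteristic 3 the images of `s` are `s³` once and 1 twice, and 1 maps only to 1. A single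
branch follows Frobenius; all others are stuck at 1. -/
theorem iterRes_map_char_three {A : Type*} [CommRing A] [IsDomain A] [CharP A 3] (φ : ℤ[X] →+* A)
    (n : ℕ) :
    (iterRes (n + 1)).map φ = C ((-1) ^ (n + 1)) *
      ((φ X ^ 3 ^ (n + 1) ::ₘ Multiset.replicate (3 ^ (n + 1) - 1) 1).map
        fun s => X - C s).prod := by
  induction n with
  | zero =>
    rw [iterRes_one_map, fPoly_char_three]
    simp
    ring
  | succ n ih =>
    rw [iterRes_succ_succ_map φ n (natDegree_iterRes_map φ n) (by simp) _ ih]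
    -- The number `3 ^ (n + 1) - 1` of copies of 1 is even, so the signs they contribute cancel.
    obtain ⟨k, hk⟩ : ∃ k, 3 ^ (n + 1) = 2 * k + 1 := (by decide : Odd 3).pow
    have hk' : 3 ^ (n + 2) - 1 = 3 * (2 * k) + 2 := by rw [pow_succ, hk]; omega
    simp only [Multiset.map_cons, Multiset.prod_cons, Multiset.map_replicate,
      Multiset.prod_replicate, fPoly_char_three]
    have hk2 : 3 ^ (n + 1) - 1 = 2 * k := by omega
    rw [show 3 ^ (n + 1 + 1) - 1 = 3 * (2 * k) + 2 from hk', hk2, pow_succ 3 (n + 1), hk]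
    have e : ((C (1 : A)) ^ 3 - X) * (X - 1) ^ 2 = - (X - C 1) ^ 3 := by
      simp only [map_one]; ring
    rw [neg_one_pow_pow_three, e, (even_two_mul k).neg_pow (_ : A[X])]
    simp only [map_pow, map_neg, map_one, ← pow_mul]
    ring

theorem map_Rpoly_char_three {A : Type*} [CommRing A] [IsDomain A] [CharP A 3] (φ : ℤ[X] →+* A)
    (n : ℕ) :
    φ (Rpoly (n + 1)) = (-1) ^ n * (φ X ^ 3 ^ (n + 1) - φ X) *
      (φ X - 1) ^ (3 ^ (n + 1) - 1) := by
  rw [map_Rpoly, iterRes_map_char_three]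
  simp
  ring

theorem Rpoly_map_zmod_three (n : ℕ) :
    (Rpoly (n + 1)).map (Int.castRingHom (ZMod 3)) =
      (-1) ^ n * (X ^ 3 ^ (n + 1) - X) * (X - 1) ^ (3 ^ (n + 1) - 1) := by
  have : Fact (Nat.Prime 3) := ⟨Nat.prime_three⟩
  simpa using map_Rpoly_char_three (mapRingHom (Int.castRingHom (ZMod 3))) n

/-! ### Growth at infinity and the degree of `R_n`. -/

section InfinitePlace

variable {K Γ : Type*} [Field K] [LinearOrderedCommGroupWithZero Γ] (v : Valuation K Γ)

theorem Valuation.map_natCast_le_one (n : ℕ) : v (n : K) ≤ 1 := by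
  induction n with
  | zero => simp
  | succ n ih =>
    rw [Nat.cast_succ]
    exact v.map_add_le ih (by simp)

theorem Valuation.map_ofNat_le_one (n : ℕ) [n.AtLeastTwo] : v (OfNat.ofNat n : K) ≤ 1 :=
  v.map_natCast_le_one n

/-- For large `b` both quadratic factors have value `v b ^ 2`, which cancels. -/
theorem valuation_of_fPoly_eq_zero {a b : K} (h : fPoly a b = 0) (hb : 1 < v b) :
    v b = v a ^ 3 := by
  have hb0 : v b ≠ 0 := (zero_lt_one.trans hb).ne'
  have hbb : v b < v (b ^ 2) := by
    rw [map_pow, sq]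
    exact (lt_mul_iff_one_lt_left (zero_lt_one.trans hb)).2 hb
  have h1 : v (b ^ 2 + b + 1) = v b ^ 2 := by
    rw [add_assoc, ← map_pow]
    refine v.map_add_eq_of_lt_left ((v.map_add_le le_rfl ?_).trans_lt hbb)
    simpa using hb.le
  have h2 : v (b ^ 2 - 2 * b + 4) = v b ^ 2 := by
    rw [sub_eq_add_neg, add_assoc, ← map_pow]
    refine v.map_add_eq_of_lt_left ((v.map_add_le (g := v b) ?_ ?_).trans_lt hbb)
    · rw [v.map_neg, map_mul]
      exact mul_le_of_le_one_left' (v.map_ofNat_le_one 2)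
    · exact (v.map_ofNat_le_one 4).trans hb.le
  have h3 := congrArg v (sub_eq_zero.1 h)
  rw [map_mul, map_mul, h1, h2, map_pow] at h3
  exact (mul_right_cancel₀ (pow_ne_zero 2 hb0) h3).symm

theorem mem_roots_fPoly {a b : K} : b ∈ (fPoly (C a) X).roots ↔ fPoly a b = 0 := by
  have : fPoly (C a) X ≠ 0 := fun h => by simpa [h] using natDegree_fPoly_C_X a
  rw [mem_roots this, IsRoot.def]
  simp [fPoly]

theorem valuation_le_one_of_fPoly_eq_zero {a b : K} (h : fPoly a b = 0) (ha : v a ≤ 1) :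
    v b ≤ 1 := by
  by_contra! hb
  have := valuation_of_fPoly_eq_zero v h hb
  rw [this] at hb
  exact hb.not_ge (pow_le_one' ha 3)

theorem one_lt_valuation_cases {A : Γ} (hA : 1 < A) {b₁ b₂ b₃ e₁ e₂ e₃ : K}
    (h₁ : b₁ + b₂ + b₃ = e₁) (h₂ : b₁ * b₂ + b₁ * b₃ + b₂ * b₃ = e₂) (h₃ : b₁ * b₂ * b₃ = e₃)
    (he₁ : v e₁ = A) (he₂ : v e₂ = A) (he₃ : v e₃ = A)
    (c₁ : 1 < v b₁ → v b₁ = A) (c₂ : 1 < v b₂ → v b₂ = A) (c₃ : 1 < v b₃ → v b₃ = A) :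
    v b₁ = A ∧ v b₂ ≤ 1 ∧ v b₃ ≤ 1 ∨ v b₂ = A ∧ v b₁ ≤ 1 ∧ v b₃ ≤ 1 ∨
      v b₃ = A ∧ v b₁ ≤ 1 ∧ v b₂ ≤ 1 := by
  have hA0 : 0 < A := zero_lt_one.trans hA
  have hAA : A < A * A := (lt_mul_iff_one_lt_left hA0).2 hA
  -- With two roots of value `A`, the product forces value `A⁻¹` on the third; then `x * y`
  -- dominates `e₂`, giving it value `A * A` instead of `A`.
  have two_large : ∀ {x y z : K}, x * y + x * z + y * z = e₂ → x * y * z = e₃ → v x = A →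
      v y = A → (1 < v z → v z = A) → False := by
    intro x y z hxy hxyz hx hy hz
    have hvz : A * v z = 1 := by
      have := congrArg v hxyz
      rw [map_mul, map_mul, hx, hy, he₃, mul_assoc] at this
      exact mul_left_cancel₀ hA0.ne' (by rw [this, mul_one])
    have := congrArg v hxy
    rw [add_assoc, v.map_add_eq_of_lt_left, he₂, map_mul, hx, hy] at this
    · exact hAA.ne' this
    · rw [v.map_mul x y, hx, hy]
      refine lt_of_le_of_lt (v.map_add_le (g := 1) ?_ ?_) (hA.trans hAA)
      · rw [map_mul, hx, hvz]
      · rw [map_mul, hy, hvz]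
  by_cases l₁ : 1 < v b₁
  · by_cases l₂ : 1 < v b₂
    · exact (two_large h₂ h₃ (c₁ l₁) (c₂ l₂) c₃).elim
    by_cases l₃ : 1 < v b₃
    · exact (two_large (x := b₁) (y := b₃) (z := b₂) (by rw [← h₂]; ring) (by rw [← h₃]; ring)
        (c₁ l₁) (c₃ l₃) c₂).elim
    exact .inl ⟨c₁ l₁, not_lt.1 l₂, not_lt.1 l₃⟩
  · by_cases l₂ : 1 < v b₂
    · by_cases l₃ : 1 < v b₃
      · exact (two_large (x := b₂) (y := b₃) (z := b₁) (by rw [← h₂]; ring) (by rw [← h₃]; ring)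
          (c₂ l₂) (c₃ l₃) c₁).elim
      exact .inr (.inl ⟨c₂ l₂, not_lt.1 l₁, not_lt.1 l₃⟩)
    · by_cases l₃ : 1 < v b₃
      · exact .inr (.inr ⟨c₃ l₃, not_lt.1 l₁, not_lt.1 l₂⟩)
      · have : v e₁ ≤ 1 := by
          rw [← h₁]
          exact v.map_add_le (v.map_add_le (not_lt.1 l₁) (not_lt.1 l₂)) (not_lt.1 l₃)
        rw [he₁] at this
        exact (hA.not_ge this).elim

/-- The elementary symmetric functions of the roots are `a ^ 3 + 2`, `-(a ^ 3 - 4)` and `a ^ 3`, all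
of value `v a ^ 3`. -/
theorem exists_roots_fPoly_eq [IsAlgClosed K] {a : K} (ha : 1 < v a) :
    ∃ r T, (fPoly (C a) X).roots = r ::ₘ T ∧ v r = v a ^ 3 ∧ ∀ t ∈ T, v t ≤ 1 := by
  obtain ⟨b₁, b₂, b₃, hb⟩ := Multiset.card_eq_three.1 (card_roots_fPoly a)
  have hA : 1 < v a ^ 3 := one_lt_pow₀ ha (by norm_num)
  have hlt : ∀ c : K, v c ≤ 1 → v (a ^ 3 + c) = v a ^ 3 := fun c hc => by
    rw [← map_pow]
    refine v.map_add_eq_of_lt_left (hc.trans_lt ?_)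
    rwa [map_pow]
  have hp := prod_roots_fPoly a
  rw [hb, fPoly_C_X] at hp
  have expand : C (-1) * ((({b₁, b₂, b₃} : Multiset K).map fun s => X - C s).prod) =
      C (-1) * X ^ 3 + C (b₁ + b₂ + b₃) * X ^ 2 + C (-(b₁ * b₂ + b₁ * b₃ + b₂ * b₃)) * X +
        C (b₁ * b₂ * b₃) := by
    simp only [Multiset.insert_eq_cons, Multiset.map_cons, Multiset.map_singleton,
      Multiset.prod_cons, Multiset.prod_singleton, map_add, map_mul, map_neg, map_one]
    ring
  rw [expand] at hp
  have e₁ := congrArg (fun p : K[X] => p.coeff 2) hp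
  have e₂ := congrArg (fun p : K[X] => p.coeff 1) hp
  have e₃ := congrArg (fun p : K[X] => p.coeff 0) hp
  simp only [coeff_add, coeff_C_mul, coeff_X_pow, coeff_X, coeff_C] at e₁ e₂ e₃
  norm_num at e₁ e₂ e₃
  have key : ∀ b ∈ ({b₁, b₂, b₃} : Multiset K), 1 < v b → v b = v a ^ 3 := fun b hbm h =>
    valuation_of_fPoly_eq_zero v (mem_roots_fPoly.1 (hb ▸ hbm)) h
  rcases one_lt_valuation_cases v hA e₁.symm (e₂ := -(a ^ 3 - 4)) (by linear_combination e₂) e₃.symm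
    (hlt _ (v.map_ofNat_le_one 2))
    (by rw [v.map_neg, sub_eq_add_neg]
        exact hlt _ (by rw [v.map_neg]; exact v.map_ofNat_le_one 4))
    (map_pow v a 3) (key _ (by simp)) (key _ (by simp)) (key _ (by simp)) with
    ⟨h, h', h''⟩ | ⟨h, h', h''⟩ | ⟨h, h', h''⟩
  · exact ⟨b₁, {b₂, b₃}, hb, h, by simp [h', h'']⟩
  · refine ⟨b₂, {b₁, b₃}, ?_, h, by simp [h', h'']⟩
    rw [hb]
    exact Multiset.cons_swap _ _ _
  · refine ⟨b₃, {b₁, b₂}, ?_, h, by simp [h', h'']⟩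
    rw [hb]
    simp only [Multiset.insert_eq_cons, ← Multiset.singleton_add]
    abel

theorem exists_iterImages_eq [IsAlgClosed K] {a : K} (ha : 1 < v a) (n : ℕ) :
    ∃ r T, iterImages a n = r ::ₘ T ∧ v r = v a ^ 3 ^ n ∧ ∀ t ∈ T, v t ≤ 1 := by
  induction n with
  | zero => exact ⟨a, 0, by simp [iterImages]⟩
  | succ n ih =>
    obtain ⟨r, T, h, hr, hT⟩ := ih
    have hr1 : 1 < v r := by
      rw [hr]
      exact one_lt_pow₀ ha (by positivity)
    obtain ⟨r', T', h', hr', hT'⟩ := exists_roots_fPoly_eq v hr1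
    refine ⟨r', T' + T.bind fun s => (fPoly (C s) X).roots, ?_, ?_, ?_⟩
    · rw [iterImages, h, Multiset.cons_bind, h', Multiset.cons_add]
    · rw [hr', hr, ← pow_mul, pow_succ]
    · intro t ht
      rcases Multiset.mem_add.1 ht with ht | ht
      · exact hT' t ht
      · obtain ⟨s, hs, hst⟩ := Multiset.mem_bind.1 ht
        exact valuation_le_one_of_fPoly_eq_zero v (mem_roots_fPoly.1 hst) (hT s hs)

/-- The unbounded branch contributes exponent `3 ^ (n + 1)`, each of the `3 ^ (n + 1) - 1` bounded
ones contributes 1. -/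
theorem valuation_map_Rpoly [IsAlgClosed K] (φ : ℤ[X] →+* K) (hφ : 1 < v (φ X)) (n : ℕ) :
    v (φ (Rpoly (n + 1))) = v (φ X) ^ (2 * 3 ^ (n + 1) - 1) := by
  obtain ⟨r, T, h, hr, hT⟩ := exists_iterImages_eq v hφ (n + 1)
  have hcard : T.card = 3 ^ (n + 1) - 1 := by
    have := card_iterImages (φ X) (n + 1)
    rw [h, Multiset.card_cons] at this
    omega
  have h1 : v (φ X - r) = v (φ X) ^ 3 ^ (n + 1) := by
    rw [← hr]
    refine v.map_sub_eq_of_lt_right ?_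
    rw [hr]
    exact lt_self_pow₀ hφ (Nat.one_lt_pow (by omega) (by omega))
  have h2 : (T.map fun s => v (φ X - s)).prod = v (φ X) ^ T.card := by
    rw [Multiset.map_congr rfl fun s hs => v.map_sub_eq_of_lt_left ((hT s hs).trans_lt hφ),
      Multiset.map_const', Multiset.prod_replicate]
  have hpos : 0 < 3 ^ (n + 1) := by positivity
  rw [map_Rpoly_eq_prod, map_mul, map_pow, v.map_neg, map_one, one_pow, one_mul, h,
    Multiset.map_cons, Multiset.prod_cons, map_mul, h1, map_multiset_prod, Multiset.map_map]
  simp only [Function.comp_def]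
  rw [h2, hcard, ← pow_add]
  congr 1
  omega

theorem valuation_aeval_eq_pow_natDegree {k : Type*} [Field k] [Algebra k K]
    (hk : ∀ c : k, v (algebraMap k K c) ≤ 1) {x : K} (hx : 1 < v x) {p : k[X]} (hp : p ≠ 0) :
    v (aeval x p) = v x ^ p.natDegree := by
  have hle : ∀ q : k[X], v (aeval x q) ≤ v x ^ q.natDegree := fun q => by
    rw [aeval_eq_sum_range]
    refine v.map_sum_le fun i hi => ?_
    rw [Algebra.smul_def, map_mul, map_pow]
    exact (mul_le_of_le_one_left' (hk _)).trans
      (pow_le_pow_right₀ hx.le (Nat.lt_succ_iff.1 (Finset.mem_range.1 hi)))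
  -- A nonzero constant and its inverse both have value at most 1.
  have hlc : v (algebraMap k K p.leadingCoeff) = 1 := by
    refine le_antisymm (hk _) ?_
    have h := hk p.leadingCoeff⁻¹
    rw [map_inv₀, map_inv₀] at h
    exact (inv_le_one₀ (zero_lt_iff.2 (by simpa using hp))).1 h
  have hlead : v (algebraMap k K p.leadingCoeff * x ^ p.natDegree) = v x ^ p.natDegree := by
    rw [map_mul, map_pow, hlc, one_mul]
  conv_lhs => rw [← p.eraseLead_add_C_mul_X_pow]
  rw [map_add, map_mul, map_pow, aeval_C, aeval_X]
  by_cases h0 : p.eraseLead = 0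
  · rw [h0, map_zero, zero_add, hlead]
  · rw [v.map_add_eq_of_lt_right, hlead]
    rw [hlead]
    exact (hle _).trans_lt (pow_lt_pow_right₀ hx
      (natDegree_lt_natDegree h0 (degree_eraseLead_lt hp)))

end InfinitePlace

theorem exists_valuation_one_lt (k : Type) [Field k] :
    ∃ V : ValuationSubring (AlgebraicClosure (RatFunc k)),
      (∀ c : k, V.valuation (algebraMap k _ c) ≤ 1) ∧
      1 < V.valuation (algebraMap (RatFunc k) _ RatFunc.X) := by
  set K := AlgebraicClosure (RatFunc k)
  set x : K := algebraMap (RatFunc k) K RatFunc.X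
  -- Being transcendental over `k`, `x` is not integral over it, so some valuation ring contains the
  -- integral closure but omits `x`.
  have hx : x ∉ (integralClosure k K).toSubring := by
    intro h
    have h1 : IsAlgebraic k x := IsIntegral.isAlgebraic h
    have h2 : IsAlgebraic k (RatFunc.X : RatFunc k) :=
      (isAlgebraic_algebraMap_iff (algebraMap (RatFunc k) K).injective).1 h1
    exact RatFunc.transcendental_X h2
  obtain ⟨V, hV, hxV⟩ := Subring.exists_le_valuationSubring_of_isIntegrallyClosedIn hx
  refine ⟨V, fun c => ?_, ?_⟩
  · rw [ValuationSubring.valuation_le_one_iff]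
    exact hV (algebraMap_mem (integralClosure k K) c)
  · rw [← not_le, ValuationSubring.valuation_le_one_iff]
    exact hxV

theorem Rpoly_map_field (k : Type) [Field k] (n : ℕ) :
    (Rpoly (n + 1)).map (Int.castRingHom k) ≠ 0 ∧
    ((Rpoly (n + 1)).map (Int.castRingHom k)).natDegree = 2 * 3 ^ (n + 1) - 1 := by
  obtain ⟨V, hV, hx⟩ := exists_valuation_one_lt k
  set x := algebraMap (RatFunc k) (AlgebraicClosure (RatFunc k)) RatFunc.X
  let φ : ℤ[X] →+* AlgebraicClosure (RatFunc k) :=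
    (aeval (R := k) x).toRingHom.comp (mapRingHom (Int.castRingHom k))
  have hφX : φ X = x := by simp [φ]
  have h := valuation_map_Rpoly V.valuation φ (by rwa [hφX]) n
  rw [hφX] at h
  have hne : (Rpoly (n + 1)).map (Int.castRingHom k) ≠ 0 := by
    intro h0
    have : φ (Rpoly (n + 1)) = 0 := by simp [φ, h0]
    rw [this, map_zero] at h
    exact pow_ne_zero _ (zero_lt_one.trans hx).ne' h.symm
  refine ⟨hne, ?_⟩
  have h' := valuation_aeval_eq_pow_natDegree V.valuation hV hx hne
  exact pow_right_injective₀ (zero_lt_one.trans hx) hx.ne' (h'.symm.trans h)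

theorem Rpoly_ne_zero (n : ℕ) : Rpoly (n + 1) ≠ 0 := fun h => by
  simpa [h] using (Rpoly_map_field ℚ n).1

theorem natDegree_Rpoly (n : ℕ) : (Rpoly (n + 1)).natDegree = 2 * 3 ^ (n + 1) - 1 := by
  rw [← (Rpoly_map_field ℚ n).2, natDegree_map_eq_of_injective (RingHom.injective_int _)]

/-- A prime dividing the leading coefficient would lower the degree modulo that prime, but the
degree is the same over every field. -/
theorem isUnit_leadingCoeff_Rpoly (n : ℕ) : IsUnit (Rpoly (n + 1)).leadingCoeff := by
  by_contra h
  obtain ⟨p, hp, hdvd⟩ := Nat.exists_prime_and_dvd (mt Int.isUnit_iff_natAbs_eq.2 h)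
  have : Fact p.Prime := ⟨hp⟩
  obtain ⟨h0, hd⟩ := Rpoly_map_field (ZMod p) n
  rw [← natDegree_Rpoly] at hd
  have hc : ((Rpoly (n + 1)).map (Int.castRingHom (ZMod p))).leadingCoeff = 0 := by
    rw [leadingCoeff, hd, coeff_map, coeff_natDegree, eq_intCast,
      ZMod.intCast_zmod_eq_zero_iff_dvd]
    exact Int.natCast_dvd.2 hdvd
  exact h0 (leadingCoeff_eq_zero.1 hc)

/-! ### Composition of chains and the reversing involution. -/

theorem mem_iterImages_succ {K : Type*} [Field K] {a b : K} {n : ℕ} :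
    b ∈ iterImages a (n + 1) ↔ ∃ t ∈ iterImages a n, fPoly t b = 0 := by
  simp only [iterImages, Multiset.mem_bind, mem_roots_fPoly]

theorem mem_iterImages_add {K : Type*} [Field K] {a b : K} {m n : ℕ} :
    b ∈ iterImages a (m + n) ↔ ∃ t ∈ iterImages a m, b ∈ iterImages t n := by
  induction n generalizing b with
  | zero => simp [iterImages]
  | succ n ih =>
    rw [← add_assoc, mem_iterImages_succ]
    simp only [ih, mem_iterImages_succ]
    exact ⟨fun ⟨t, ⟨s, hs, hst⟩, h⟩ => ⟨s, hs, t, hst, h⟩,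
      fun ⟨s, hs, t, hst, h⟩ => ⟨t, ⟨s, hs, hst⟩, h⟩⟩

theorem mem_iterImages_self_mul {K : Type*} [Field K] {a : K} {d : ℕ} (h : a ∈ iterImages a d)
    (k : ℕ) : a ∈ iterImages a (d * k) := by
  induction k with
  | zero => simp [iterImages]
  | succ k ih =>
    rw [Nat.mul_succ]
    exact mem_iterImages_add.2 ⟨a, ih, h⟩

theorem one_mem_iterImages_one {K : Type*} [Field K] (n : ℕ) : (1 : K) ∈ iterImages 1 n := by
  have h : (1 : K) ∈ iterImages 1 1 :=
    mem_iterImages_succ.2 ⟨1, by simp [iterImages], by simp only [fPoly]; ring⟩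
  simpa using mem_iterImages_self_mul h n

/-- Since `f(1, b) = -(b - 1)³`, a chain that reaches 1, the pole of the involution, never leaves
it. -/
theorem fPoly_one_left_eq_zero {K : Type*} [Field K] {b : K} (h : fPoly 1 b = 0) : b = 1 := by
  have : (b - 1) ^ 3 = 0 := by
    simp only [fPoly] at h
    linear_combination -h
  exact sub_eq_zero.1 (pow_eq_zero_iff (by norm_num) |>.1 this)

/-- The involution `a ↦ (a + 2) / (a - 1)`, that is `(a - 1) (a' - 1) = 3`, reverses the
correspondence. -/
theorem fPoly_involution {K : Type*} [Field K] (h3 : (3 : K) ≠ 0) {a b a' b' : K}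
    (ha : (a - 1) * (a' - 1) = 3) (hb : (b - 1) * (b' - 1) = 3) (h : fPoly a b = 0) :
    fPoly b' a' = 0 := by
  have ha0 : a - 1 ≠ 0 := left_ne_zero_of_mul (ha ▸ h3)
  have hb0 : b - 1 ≠ 0 := left_ne_zero_of_mul (hb ▸ h3)
  obtain rfl : a' = 3 / (a - 1) + 1 := by
    field_simp
    linear_combination ha
  obtain rfl : b' = 3 / (b - 1) + 1 := by
    field_simp
    linear_combination hb
  have : fPoly (3 / (b - 1) + 1) (3 / (a - 1) + 1) * ((a - 1) ^ 3 * (b - 1) ^ 3) =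
      27 * fPoly a b := by
    simp only [fPoly]
    field_simp
    ring
  rw [h, mul_zero] at this
  exact (mul_eq_zero.1 this).resolve_right (by simp [ha0, hb0])

theorem mem_iterImages_involution {K : Type*} [Field K] (h3 : (3 : K) ≠ 0) {a b a' b' : K}
    {n : ℕ} (ha : (a - 1) * (a' - 1) = 3) (hb : (b - 1) * (b' - 1) = 3)
    (h : b ∈ iterImages a n) : a' ∈ iterImages b' n := by
  induction n generalizing b b' with
  | zero =>
    obtain rfl : b = a := by simpa [iterImages] using h
    have hb0 : b - 1 ≠ 0 := left_ne_zero_of_mul (hb ▸ h3)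
    have : a' = b' := by
      have := mul_left_cancel₀ hb0 (ha.trans hb.symm)
      exact sub_left_injective this
    simp [iterImages, this]
  | succ n ih =>
    obtain ⟨t, ht, htb⟩ := mem_iterImages_succ.1 h
    have ht1 : t - 1 ≠ 0 := by
      intro h0
      rw [sub_eq_zero.1 h0] at htb
      rw [fPoly_one_left_eq_zero htb] at hb
      rw [sub_self, zero_mul] at hb
      exact h3 hb.symm
    have htt : (t - 1) * ((3 / (t - 1) + 1) - 1) = 3 := by field_simp; ring
    rw [add_comm]
    refine mem_iterImages_add.2 ⟨3 / (t - 1) + 1, ?_, ih htt ht⟩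
    exact mem_iterImages_succ.2 ⟨b', by simp [iterImages], fPoly_involution h3 htt hb htb⟩

theorem aeval_Rpoly_eq_zero_iff {K : Type*} [Field K] [IsAlgClosed K] {a : K} {n : ℕ} :
    aeval a (Rpoly (n + 1)) = 0 ↔ a ∈ iterImages a (n + 1) := by
  simpa using map_Rpoly_eq_zero_iff (aeval a).toRingHom n

theorem aeval_Rpoly_involution {K : Type*} [Field K] [IsAlgClosed K] (h3 : (3 : K) ≠ 0) {a a' : K}
    (ha : (a - 1) * (a' - 1) = 3) {n : ℕ} (h : aeval a (Rpoly (n + 1)) = 0) :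
    aeval a' (Rpoly (n + 1)) = 0 := by
  rw [aeval_Rpoly_eq_zero_iff] at h ⊢
  exact mem_iterImages_involution h3 ha ha h

theorem aeval_one_Rpoly {K : Type*} [Field K] [IsAlgClosed K] (n : ℕ) :
    aeval (1 : K) (Rpoly (n + 1)) = 0 :=
  aeval_Rpoly_eq_zero_iff.2 (one_mem_iterImages_one _)

theorem aeval_Rpoly_of_dvd {K : Type*} [Field K] [IsAlgClosed K] {a : K} {m n : ℕ}
    (h : aeval a (Rpoly (m + 1)) = 0) (hmn : m + 1 ∣ n + 1) : aeval a (Rpoly (n + 1)) = 0 := by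
  obtain ⟨k, hk⟩ := hmn
  rw [aeval_Rpoly_eq_zero_iff] at h ⊢
  rw [hk]
  exact mem_iterImages_self_mul h k

/-! ### Algebraic integers and a residue field of characteristic 3. -/

/-- The ring of all algebraic integers in `ℂ`. -/
abbrev AlgInt : Subalgebra ℤ ℂ := integralClosure ℤ ℂ

theorem mem_algInt_of_leadingCoeff_isUnit {p : ℤ[X]} (hp : IsUnit p.leadingCoeff) {a : ℂ}
    (ha : aeval a p = 0) : a ∈ AlgInt := by
  have h := RingHom.isIntegralElem_leadingCoeff_mul (algebraMap ℤ ℂ) p a ha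
  have h2 := IsIntegral.smul p.leadingCoeff (show IsIntegral ℤ _ from h)
  -- A unit of `ℤ` is its own inverse.
  have : p.leadingCoeff • (algebraMap ℤ ℂ p.leadingCoeff * a) = a := by
    rw [Algebra.smul_def, ← mul_assoc, ← map_mul, Int.isUnit_mul_self hp, map_one, one_mul]
  rwa [this] at h2

theorem splits_algInt {p : ℤ[X]} (hp : IsUnit p.leadingCoeff) :
    (p.map (algebraMap ℤ AlgInt)).Splits := by
  have hroots : ∀ a ∈ p.aroots ℂ, a ∈ AlgInt := fun a ha =>
    mem_algInt_of_leadingCoeff_isUnit hp (mem_aroots.1 ha).2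
  lift p.aroots ℂ to Multiset AlgInt using hroots with U hU
  have : p.map (algebraMap ℤ AlgInt) =
      C (algebraMap ℤ AlgInt p.leadingCoeff) * (U.map fun s => X - C s).prod := by
    apply map_injective (algebraMap AlgInt ℂ) Subtype.val_injective
    rw [Polynomial.map_mul, Polynomial.map_map, ← IsScalarTower.algebraMap_eq, map_C,
      Polynomial.map_multiset_prod, Multiset.map_map]
    conv_lhs => rw [eq_C_mul_prod_roots (p.map (algebraMap ℤ ℂ))]
    rw [← aroots_def, ← hU, Multiset.map_map,
      leadingCoeff_map_of_injective (RingHom.injective_int _)]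
    simp
  rw [this]
  refine (Splits.C _).mul (Splits.multisetProd ?_)
  intro f hf
  obtain ⟨s, -, rfl⟩ := Multiset.mem_map.1 hf
  exact Splits.X_sub_C _

/-- As `1 / 3` is not an algebraic integer, 3 lies in a maximal ideal. -/
theorem exists_algInt_residue_field :
    ∃ (κ : Type) (_ : Field κ) (_ : CharP κ 3), Nonempty (AlgInt →+* κ) := by
  have h3 : ¬ IsUnit (3 : AlgInt) := by
    intro h
    obtain ⟨y, hy⟩ := h.exists_right_inv
    have hy' : (3 : ℂ) * y = 1 := congrArg Subtype.val hy
    have hyq : (y : ℂ) = algebraMap ℚ ℂ (1 / 3) := by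
      rw [eq_ratCast]
      push_cast
      linear_combination hy' / 3
    have hint : IsIntegral ℤ (algebraMap ℚ ℂ (1 / 3)) := hyq ▸ y.2
    rw [isIntegral_algebraMap_iff (algebraMap ℚ ℂ).injective] at hint
    obtain ⟨z, hz⟩ := IsIntegrallyClosed.isIntegral_iff.1 hint
    have : 3 * z = 1 := by
      rify
      have := congrArg (fun q : ℚ => (q : ℝ)) hz
      simp at this
      rw [this]
      norm_num
    omega
  obtain ⟨M, hM, h3M⟩ := exists_max_ideal_of_mem_nonunits h3
  have := hM
  refine ⟨AlgInt ⧸ M, Ideal.Quotient.field M, ?_, ⟨Ideal.Quotient.mk M⟩⟩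
  have h0 : ((3 : ℕ) : AlgInt ⧸ M) = 0 := by
    have := Ideal.Quotient.eq_zero_iff_mem.2 h3M
    rwa [map_ofNat] at this
  exact (CharP.charP_iff_prime_eq_zero Nat.prime_three).2 h0

/-! ### Counting the roots of `R_n` by residue. -/

section Residue

variable {κ : Type} [Field κ] [CharP κ 3] (π : AlgInt →+* κ)

/-- The roots of `R_n` as a multiset of algebraic integers. -/
noncomputable abbrev algIntRoots (n : ℕ) : Multiset AlgInt :=
  ((Rpoly n).map (algebraMap ℤ AlgInt)).roots

theorem map_algIntRoots (n : ℕ) : (algIntRoots (n + 1)).map Subtype.val = (Rpoly (n + 1)).aroots ℂ := by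
  have := (splits_algInt (isUnit_leadingCoeff_Rpoly n)).roots_map_of_injective
    (i := algebraMap AlgInt ℂ) Subtype.val_injective
  rw [Polynomial.map_map, ← IsScalarTower.algebraMap_eq] at this
  exact this.symm

theorem mem_algIntRoots {n : ℕ} {u : AlgInt} :
    u ∈ algIntRoots (n + 1) ↔ aeval (u : ℂ) (Rpoly (n + 1)) = 0 := by
  rw [← Multiset.mem_map_of_injective Subtype.val_injective, map_algIntRoots, mem_aroots,
    and_iff_right (Rpoly_ne_zero n)]

theorem card_algIntRoots (n : ℕ) : (algIntRoots (n + 1)).card = 2 * 3 ^ (n + 1) - 1 := by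
  rw [← (splits_algInt (isUnit_leadingCoeff_Rpoly n)).natDegree_eq_card_roots,
    natDegree_map_eq_of_injective (RingHom.injective_int _), natDegree_Rpoly]

theorem residue_algIntRoots (n : ℕ) : (algIntRoots (n + 1)).map π =
    (X ^ 3 ^ (n + 1) - X : κ[X]).roots + Multiset.replicate (3 ^ (n + 1) - 1) 1 := by
  have hR : ((Rpoly (n + 1)).map (algebraMap ℤ AlgInt)).map π =
      C ((-1) ^ n) * ((X ^ 3 ^ (n + 1) - X : κ[X]) * (X - C 1) ^ (3 ^ (n + 1) - 1)) := by
    have := map_Rpoly_char_three (mapRingHom (Int.castRingHom κ)) n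
    simp only [coe_mapRingHom, map_X] at this
    rw [Polynomial.map_map, RingHom.ext_int (π.comp (algebraMap ℤ AlgInt)) (Int.castRingHom κ),
      this]
    simp [mul_assoc]
  have hsep : (X ^ 3 ^ (n + 1) - X : κ[X]).Separable :=
    galois_poly_separable 3 _ (dvd_pow_self 3 (by omega))
  have hne : (X ^ 3 ^ (n + 1) - X : κ[X]) * (X - C 1) ^ (3 ^ (n + 1) - 1) ≠ 0 :=
    mul_ne_zero hsep.ne_zero (pow_ne_zero _ (X_sub_C_ne_zero 1))
  have hne' : ((Rpoly (n + 1)).map (algebraMap ℤ AlgInt)).map π ≠ 0 := by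
    rw [hR]
    exact mul_ne_zero (by simp) hne
  rw [← (splits_algInt (isUnit_leadingCoeff_Rpoly n)).roots_map_of_ne_zero hne', hR,
    roots_C_mul _ (by simp), roots_mul hne, roots_pow, roots_X_sub_C, Multiset.nsmul_singleton]

open Classical in
theorem residue_filter_algIntRoots (n : ℕ) :
    ((algIntRoots (n + 1)).filter fun u => π u ≠ 1).map π =
      (X ^ 3 ^ (n + 1) - X : κ[X]).roots.erase 1 ∧
    ((X ^ 3 ^ (n + 1) - X : κ[X]).roots.erase 1).Nodup ∧
    ((X ^ 3 ^ (n + 1) - X : κ[X]).roots.erase 1).card = 3 ^ (n + 1) - 1 := by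
  have hsep : (X ^ 3 ^ (n + 1) - X : κ[X]).Separable :=
    galois_poly_separable 3 _ (dvd_pow_self 3 (by omega))
  have hnd := nodup_roots hsep
  have hmap := residue_algIntRoots π n
  refine ⟨?_, hnd.erase _, ?_⟩
  · have := Multiset.filter_map (p := fun b : κ => b ≠ 1) π (algIntRoots (n + 1))
    rw [hmap, Multiset.filter_add] at this
    rw [hnd.erase_eq_filter]
    rw [Multiset.filter_eq_nil (s := Multiset.replicate _ _) |>.2, add_zero] at this
    · exact this.symm
    · intro a ha
      simp [Multiset.eq_of_mem_replicate ha]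
  · have h1 : (1 : κ) ∈ (X ^ 3 ^ (n + 1) - X : κ[X]).roots := by
      rw [mem_roots hsep.ne_zero]
      simp
    -- `κ` is not assumed algebraically closed: the number of roots of `X ^ 3 ^ (n + 1) - X` in it
    -- is deduced from the total `2 * 3 ^ (n + 1) - 1`.
    have hc := congrArg Multiset.card hmap
    rw [Multiset.card_map, card_algIntRoots, Multiset.card_add, Multiset.card_replicate] at hc
    rw [Multiset.card_erase_of_mem h1, Nat.pred_eq_sub_one]
    omega

theorem eq_of_residue_eq {n : ℕ} {u w : AlgInt} (hu : u ∈ algIntRoots (n + 1))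
    (hw : w ∈ algIntRoots (n + 1)) (hu1 : π u ≠ 1) (h : π u = π w) : u = w := by
  classical
  obtain ⟨h1, h2, -⟩ := residue_filter_algIntRoots π n
  rw [← h1] at h2
  exact Multiset.inj_on_of_nodup_map h2 u (Multiset.mem_filter.2 ⟨hu, hu1⟩) w
    (Multiset.mem_filter.2 ⟨hw, h ▸ hu1⟩) h

theorem exists_algIntRoots_residue_iff {n : ℕ} {b : κ} (hb : b ≠ 1) :
    (∃ u ∈ algIntRoots (n + 1), π u = b) ↔ b ^ 3 ^ (n + 1) = b := by
  classical
  have hsep : (X ^ 3 ^ (n + 1) - X : κ[X]).Separable :=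
    galois_poly_separable 3 _ (dvd_pow_self 3 (by omega))
  rw [← Multiset.mem_map, residue_algIntRoots, Multiset.mem_add, mem_roots hsep.ne_zero,
    or_iff_left fun h => hb (Multiset.eq_of_mem_replicate h)]
  simp [sub_eq_zero]

theorem exists_involution_algIntRoots {n : ℕ} {u : AlgInt} (hu : u ∈ algIntRoots (n + 1))
    (hu1 : π u ≠ 1) : ∃ w ∈ algIntRoots (n + 1), (u - 1) * (w - 1) = 3 ∧ π w = 1 := by
  have h0 : (u : ℂ) - 1 ≠ 0 := by
    intro h
    have : u = 1 := Subtype.ext (sub_eq_zero.1 h)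
    exact hu1 (by rw [this, map_one])
  have hinv : ((u : ℂ) - 1) * ((3 / ((u : ℂ) - 1) + 1) - 1) = 3 := by field_simp; ring
  have hroot := aeval_Rpoly_involution (by norm_num) hinv (mem_algIntRoots.1 hu)
  refine ⟨⟨_, mem_algInt_of_leadingCoeff_isUnit (isUnit_leadingCoeff_Rpoly n) hroot⟩,
    mem_algIntRoots.2 hroot, Subtype.ext hinv, ?_⟩
  set w : AlgInt := ⟨_, mem_algInt_of_leadingCoeff_isUnit (isUnit_leadingCoeff_Rpoly n) hroot⟩
  have h : (u - 1) * (w - 1) = 3 := Subtype.ext hinv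
  have h' := congrArg π h
  rw [map_mul, map_sub, map_sub, map_one, map_ofNat] at h'
  have h3 : (3 : κ) = 0 := by simpa using CharP.cast_eq_zero κ 3
  rw [h3] at h'
  exact sub_eq_zero.1 ((mul_eq_zero.1 h').resolve_left (sub_ne_zero.2 hu1))

theorem algIntRoots_nodup_and_cases (n : ℕ) : (algIntRoots (n + 1)).Nodup ∧
    ∀ u ∈ algIntRoots (n + 1), u = 1 ∨ π u ≠ 1 ∨
      ∃ w ∈ algIntRoots (n + 1), π w ≠ 1 ∧ (w - 1) * (u - 1) = 3 := by
  classical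
  obtain ⟨h1, h2, h3⟩ := residue_filter_algIntRoots π n
  set B := (algIntRoots (n + 1)).filter fun u => π u ≠ 1 with hB
  have hBnd : B.Nodup := Multiset.Nodup.of_map π (h1 ▸ h2)
  have hBcard : B.toFinset.card = 3 ^ (n + 1) - 1 := by
    rw [Multiset.toFinset_card_of_nodup hBnd, ← h3, ← h1, Multiset.card_map]
  have hmemB : ∀ u, u ∈ B.toFinset ↔ u ∈ algIntRoots (n + 1) ∧ π u ≠ 1 := fun u => by
    rw [Multiset.mem_toFinset, hB, Multiset.mem_filter]
  have hex : ∀ u, ∃ w, u ∈ B.toFinset →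
      w ∈ algIntRoots (n + 1) ∧ (u - 1) * (w - 1) = 3 ∧ π w = 1 := fun u => by
    by_cases hu : u ∈ B.toFinset
    · obtain ⟨w, hw⟩ := exists_involution_algIntRoots π ((hmemB u).1 hu).1 ((hmemB u).1 hu).2
      exact ⟨w, fun _ => hw⟩
    · exact ⟨0, fun h => (hu h).elim⟩
  choose g hg using hex
  have h30 : (3 : AlgInt) ≠ 0 := by norm_num
  have hginj : Set.InjOn g B.toFinset := by
    intro u hu w hw huw
    have e1 := (hg u hu).2.1
    have e2 := (hg w hw).2.1
    rw [← huw] at e2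
    have := mul_right_cancel₀ (right_ne_zero_of_mul (e1 ▸ h30)) (e1.trans e2.symm)
    exact sub_left_injective this
  -- These roots number `1 + 2 * (3 ^ (n + 1) - 1)`, which is the degree, so there are no others and
  -- none is repeated.
  set E := insert 1 (B.toFinset ∪ B.toFinset.image g) with hE
  have hdisj : Disjoint B.toFinset (B.toFinset.image g) := by
    rw [Finset.disjoint_left]
    intro u hu hu'
    obtain ⟨w, hw, rfl⟩ := Finset.mem_image.1 hu'
    exact ((hmemB _).1 hu).2 (hg w hw).2.2
  have hone : (1 : AlgInt) ∉ B.toFinset ∪ B.toFinset.image g := by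
    intro h
    rcases Finset.mem_union.1 h with h | h
    · exact ((hmemB _).1 h).2 (map_one π)
    · obtain ⟨w, hw, hw1⟩ := Finset.mem_image.1 h
      have := (hg w hw).2.1
      rw [hw1, sub_self, mul_zero] at this
      exact h30 this.symm
  have hEcard : E.card = (algIntRoots (n + 1)).card := by
    rw [hE, Finset.card_insert_of_notMem hone, Finset.card_union_of_disjoint hdisj,
      Finset.card_image_of_injOn hginj, hBcard, card_algIntRoots]
    have : 0 < 3 ^ (n + 1) := by positivity
    omega
  have hEsub : E ⊆ (algIntRoots (n + 1)).toFinset := by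
    intro u hu
    rw [Multiset.mem_toFinset]
    rcases Finset.mem_insert.1 hu with rfl | hu
    · exact mem_algIntRoots.2 (aeval_one_Rpoly n)
    rcases Finset.mem_union.1 hu with hu | hu
    · exact ((hmemB _).1 hu).1
    · obtain ⟨w, hw, rfl⟩ := Finset.mem_image.1 hu
      exact (hg w hw).1
  have hEeq : E = (algIntRoots (n + 1)).toFinset :=
    Finset.eq_of_subset_of_card_le hEsub (hEcard ▸ Multiset.toFinset_card_le _)
  refine ⟨Multiset.toFinset_card_eq_card_iff_nodup.1 (hEeq ▸ hEcard), fun u hu => ?_⟩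
  rw [← Multiset.mem_toFinset, ← hEeq] at hu
  rcases Finset.mem_insert.1 hu with rfl | hu
  · exact .inl rfl
  rcases Finset.mem_union.1 hu with hu | hu
  · exact .inr (.inl ((hmemB _).1 hu).2)
  · obtain ⟨w, hw, rfl⟩ := Finset.mem_image.1 hu
    exact .inr (.inr ⟨w, ((hmemB _).1 hw).1, ((hmemB _).1 hw).2, (hg w hw).2.1⟩)

/-- The period is that of the residue under cubing. Some root of `R_d` has the same residue; since
`d ∣ m + 1` it is also a root of `R_{m+1}`, hence equals `u` by uniqueness of lifts. -/
theorem exists_period_of_residue_ne_one {m : ℕ} {u : AlgInt} (hu : u ∈ algIntRoots (m + 1))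
    (hu1 : π u ≠ 1) : ∃ d, 0 < d ∧ ∀ n, u ∈ algIntRoots (n + 1) ↔ d ∣ n + 1 := by
  have hfrob : ∀ n, (fun b : κ => b ^ 3)^[n] (π u) = π u ^ 3 ^ n := fun n => by
    rw [pow_iterate]
  have hper : ∀ n, Function.IsPeriodicPt (fun b : κ => b ^ 3) n (π u) ↔
      π u ^ 3 ^ n = π u := fun n => by
    rw [Function.IsPeriodicPt, Function.IsFixedPt, hfrob]
  set d := Function.minimalPeriod (fun b : κ => b ^ 3) (π u) with hd
  have hpos : 0 < d := Function.IsPeriodicPt.minimalPeriod_pos (Nat.succ_pos m)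
    ((hper _).2 ((exists_algIntRoots_residue_iff π hu1).1 ⟨u, hu, rfl⟩))
  obtain ⟨e, he⟩ : ∃ e, d = e + 1 := ⟨d - 1, by omega⟩
  have hdm : ∀ n, u ∈ algIntRoots (n + 1) → d ∣ n + 1 := fun n hn =>
    ((hper _).2 ((exists_algIntRoots_residue_iff π hu1).1 ⟨u, hn, rfl⟩)).minimalPeriod_dvd
  have hdu : u ∈ algIntRoots (e + 1) := by
    have : π u ^ 3 ^ (e + 1) = π u :=
      (hper _).1 (he ▸ Function.isPeriodicPt_minimalPeriod _ _)
    obtain ⟨w, hw, hwu⟩ := (exists_algIntRoots_residue_iff π hu1).2 this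
    have hw' : w ∈ algIntRoots (m + 1) :=
      mem_algIntRoots.2 (aeval_Rpoly_of_dvd (mem_algIntRoots.1 hw) (he ▸ hdm m hu))
    rwa [eq_of_residue_eq π hu hw' hu1 hwu.symm]
  exact ⟨d, hpos, fun n => ⟨hdm n, fun h =>
    mem_algIntRoots.2 (aeval_Rpoly_of_dvd (mem_algIntRoots.1 hdu) (he ▸ h))⟩⟩

end Residue

/-! ### Exact periods and the polynomials `P_n`. -/

theorem hasDistinctRoots_Rpoly (n : ℕ) : HasDistinctRoots (Rpoly (n + 1)) := by
  obtain ⟨κ, _, _, ⟨π⟩⟩ := exists_algInt_residue_field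
  refine ⟨Rpoly_ne_zero n, ?_⟩
  rw [← map_algIntRoots]
  exact (algIntRoots_nodup_and_cases π n).1.map Subtype.val_injective

/-- The `n` for which a complex number is a root of `R_n` are the multiples of its period. -/
theorem exists_period {m : ℕ} {a : ℂ} (ha : aeval a (Rpoly (m + 1)) = 0) :
    ∃ d, 0 < d ∧ ∀ n, aeval a (Rpoly (n + 1)) = 0 ↔ d ∣ n + 1 := by
  obtain ⟨κ, _, _, ⟨π⟩⟩ := exists_algInt_residue_field
  lift a to AlgInt using mem_algInt_of_leadingCoeff_isUnit (isUnit_leadingCoeff_Rpoly m) ha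
  rcases (algIntRoots_nodup_and_cases π m).2 a (mem_algIntRoots.2 ha) with rfl | h | ⟨w, hw, hw1, h⟩
  · exact ⟨1, one_pos, fun n => by simpa using aeval_one_Rpoly n⟩
  · obtain ⟨d, hd, h⟩ := exists_period_of_residue_ne_one π (mem_algIntRoots.2 ha) h
    exact ⟨d, hd, fun n => by rw [← h, mem_algIntRoots]⟩
  -- A root with residue 1 other than 1 inherits the period of its partner under the involution.
  · obtain ⟨d, hd, h'⟩ := exists_period_of_residue_ne_one π hw hw1
    refine ⟨d, hd, fun n => ?_⟩
    have hC : ((w : ℂ) - 1) * ((a : ℂ) - 1) = 3 := congrArg Subtype.val h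
    rw [← h', mem_algIntRoots]
    exact ⟨aeval_Rpoly_involution (by norm_num) (by rw [mul_comm, hC]),
      aeval_Rpoly_involution (by norm_num) hC⟩

/-- Up to a unit `p` is monic, so divisibility descends from `ℂ` to `ℤ`. -/
theorem map_complex_dvd_iff {p q : ℤ[X]} (hp : IsUnit p.leadingCoeff) :
    p.map (algebraMap ℤ ℂ) ∣ q.map (algebraMap ℤ ℂ) ↔ p ∣ q := by
  have hu : IsUnit (C p.leadingCoeff : ℤ[X]) := hp.map C
  have hm : (C p.leadingCoeff * p).Monic := by
    rw [Monic, leadingCoeff_mul, leadingCoeff_C, Int.isUnit_mul_self hp]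
  rw [← hu.mul_left_dvd (a := p), ← Polynomial.map_dvd_map (algebraMap ℤ ℂ) (RingHom.injective_int _) hm,
    Polynomial.map_mul]
  exact (IsUnit.mul_left_dvd (hu.map (mapRingHom (algebraMap ℤ ℂ)))).symm

theorem dvd_of_aroots_subset {p q : ℤ[X]} (hp : IsUnit p.leadingCoeff)
    (hnd : (p.aroots ℂ).Nodup) (hq : q ≠ 0)
    (h : ∀ a : ℂ, aeval a p = 0 → aeval a q = 0) :
    p.map (algebraMap ℤ ℂ) ∣ q.map (algebraMap ℤ ℂ) := by
  have hp0 : p ≠ 0 := fun h => by simp [h] at hp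
  have hinj := RingHom.injective_int (algebraMap ℤ ℂ)
  rw [IsAlgClosed.dvd_iff_roots_le_roots ((Polynomial.map_ne_zero_iff hinj).2 hp0)
    ((Polynomial.map_ne_zero_iff hinj).2 hq), ← aroots_def, ← aroots_def,
    Multiset.le_iff_subset hnd]
  exact fun a ha => mem_aroots.2 ⟨hq, h a (mem_aroots.1 ha).2⟩

theorem hasDistinctRoots_of_dvd {p q : ℤ[X]} (hq : HasDistinctRoots q) (h : p ∣ q) :
    HasDistinctRoots p := by
  refine ⟨ne_zero_of_dvd_ne_zero hq.1 h, ?_⟩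
  have hinj := RingHom.injective_int (algebraMap ℤ ℂ)
  refine Multiset.nodup_of_le (roots.le_of_dvd ?_ ?_) hq.2
  · exact (Polynomial.map_ne_zero_iff hinj).2 hq.1
  · exact Polynomial.map_dvd _ h

theorem aeval_ne_zero_of_mul_hasDistinctRoots {p q : ℤ[X]} (h : HasDistinctRoots (p * q)) {a : ℂ}
    (ha : aeval a p = 0) : aeval a q ≠ 0 := by
  intro hq
  have hnd := h.2
  rw [aroots_mul h.1, Multiset.nodup_add] at hnd
  exact Multiset.disjoint_left.1 hnd.2.2 (mem_aroots.2 ⟨left_ne_zero_of_mul h.1, ha⟩)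
    (mem_aroots.2 ⟨right_ne_zero_of_mul h.1, hq⟩)

theorem algebraMap_Rpoly_ne_zero {n : ℕ} (hn : 0 < n) :
    algebraMap ℤ[X] (FractionRing ℤ[X]) (Rpoly n) ≠ 0 := by
  obtain ⟨m, rfl⟩ := Nat.exists_eq_succ_of_ne_zero hn.ne'
  exact (map_ne_zero_iff _ (IsFractionRing.injective _ _)).2 (Rpoly_ne_zero m)

theorem Pfrac_ne_zero {n : ℕ} : Pfrac n ≠ 0 :=
  Finset.prod_ne_zero_iff.2 fun _ hk =>
    zpow_ne_zero _ (algebraMap_Rpoly_ne_zero (Nat.pos_of_mem_divisors hk))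

theorem prod_Pfrac {n : ℕ} (hn : 0 < n) :
    ∏ d ∈ n.divisors, Pfrac d = algebraMap ℤ[X] (FractionRing ℤ[X]) (Rpoly n) := by
  refine (ArithmeticFunction.prod_eq_iff_prod_pow_moebius_eq_of_nonzero (f := Pfrac)
    (fun _ _ => Pfrac_ne_zero) fun n hn => algebraMap_Rpoly_ne_zero hn).2 (fun n _ => ?_) n hn
  exact Nat.prod_divisorsAntidiagonal' fun i j =>
    algebraMap ℤ[X] (FractionRing ℤ[X]) (Rpoly j) ^ ArithmeticFunction.moebius i

/-- The roots of `p` are the complex numbers of exact period `n`. -/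
def RootsHavePeriod (p : ℤ[X]) (n : ℕ) : Prop :=
  ∀ a : ℂ, aeval a p = 0 ↔ ∀ m, aeval a (Rpoly (m + 1)) = 0 ↔ n ∣ m + 1

theorem RootsHavePeriod.isCoprime {p q : ℤ[X]} {m n : ℕ} (hm : 0 < m) (hn : 0 < n) (hmn : m ≠ n)
    (hp : RootsHavePeriod p m) (hq : RootsHavePeriod q n) :
    IsCoprime (p.map (algebraMap ℤ ℂ)) (q.map (algebraMap ℤ ℂ)) := by
  rw [isCoprime_iff_aeval_ne_zero_of_isAlgClosed ℂ ℂ]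
  intro a
  rw [aeval_map_algebraMap, aeval_map_algebraMap, ← not_and_or]
  rintro ⟨h1, h2⟩
  have h1 := (hp a).1 h1
  have h2 := (hq a).1 h2
  obtain ⟨m, rfl⟩ := Nat.exists_eq_succ_of_ne_zero hm.ne'
  obtain ⟨n, rfl⟩ := Nat.exists_eq_succ_of_ne_zero hn.ne'
  exact hmn (Nat.dvd_antisymm ((h1 n).1 ((h2 n).2 dvd_rfl)) ((h2 m).1 ((h1 m).2 dvd_rfl)))

/-- The factors for proper divisors of `n` have disjoint root sets, so their product divides `R_n`.
The quotient is `P_n`, by cancellation in `∏_{d ∣ n} P_d = R_n`. -/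
theorem exists_Pfrac_eq (n : ℕ) (hn : 0 < n) :
    ∃ p : ℤ[X], algebraMap ℤ[X] (FractionRing ℤ[X]) p = Pfrac n ∧ p ∣ Rpoly n ∧
      RootsHavePeriod p n := by
  induction n using Nat.strong_induction_on with
  | _ n ih =>
  have hpd : ∀ d ∈ n.properDivisors, 0 < d ∧ d < n ∧ d ∣ n := fun d hd =>
    ⟨Nat.pos_of_mem_properDivisors hd, (Nat.mem_properDivisors.1 hd).2,
      (Nat.mem_properDivisors.1 hd).1⟩
  have : ∀ d, ∃ p : ℤ[X], d ∈ n.properDivisors →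
      algebraMap ℤ[X] (FractionRing ℤ[X]) p = Pfrac d ∧ p ∣ Rpoly d ∧ RootsHavePeriod p d := by
    intro d
    by_cases hd : d ∈ n.properDivisors
    · obtain ⟨p, hp⟩ := ih d (hpd d hd).2.1 (hpd d hd).1
      exact ⟨p, fun _ => hp⟩
    · exact ⟨0, fun h => (hd h).elim⟩
  choose p hp using this
  obtain ⟨n, rfl⟩ := Nat.exists_eq_succ_of_ne_zero hn.ne'
  rw [Nat.succ_eq_add_one] at *
  have hdist : ∀ d ∈ (n + 1).properDivisors,
      IsUnit (p d).leadingCoeff ∧ HasDistinctRoots (p d) := by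
    intro d hd
    obtain ⟨e, rfl⟩ := Nat.exists_eq_succ_of_ne_zero (hpd d hd).1.ne'
    exact ⟨isUnit_of_dvd_unit (leadingCoeff_dvd_leadingCoeff (hp _ hd).2.1)
      (isUnit_leadingCoeff_Rpoly e),
      hasDistinctRoots_of_dvd (hasDistinctRoots_Rpoly e) (hp _ hd).2.1⟩
  have hlc : IsUnit (∏ d ∈ (n + 1).properDivisors, p d).leadingCoeff := by
    rw [leadingCoeff_prod]
    exact IsUnit.prod_iff.2 fun d hd => (hdist d hd).1
  have hdvd : ∏ d ∈ (n + 1).properDivisors, p d ∣ Rpoly (n + 1) := by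
    rw [← map_complex_dvd_iff hlc, Polynomial.map_prod]
    refine Finset.prod_dvd_of_coprime ?_ fun d hd => ?_
    · intro d hd e he hde
      exact (hp d hd).2.2.isCoprime (hpd d hd).1 (hpd e he).1 hde (hp e he).2.2
    · refine dvd_of_aroots_subset (hdist d hd).1 (hdist d hd).2.2 (Rpoly_ne_zero n) fun a ha => ?_
      exact (((hp d hd).2.2 a).1 ha n).2 (hpd d hd).2.2
  obtain ⟨q, hq⟩ := hdvd
  have hD0 : ∏ d ∈ (n + 1).properDivisors, p d ≠ 0 := fun h => by simp [h] at hlc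
  refine ⟨q, ?_, hq ▸ dvd_mul_left _ _, fun a => ⟨fun ha => ?_, fun ha => ?_⟩⟩
  · have h := prod_Pfrac hn
    rw [← Nat.cons_self_properDivisors hn.ne', Finset.prod_cons, hq, map_mul, map_prod,
      Finset.prod_congr rfl fun d hd => (hp d hd).1, mul_comm] at h
    exact (mul_left_cancel₀ (Finset.prod_ne_zero_iff.2 fun d _ => Pfrac_ne_zero) h).symm
  · have hR : aeval a (Rpoly (n + 1)) = 0 := by rw [hq, map_mul, ha, mul_zero]
    obtain ⟨e, he, h⟩ := exists_period hR
    rcases eq_or_ne e (n + 1) with rfl | hne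
    · exact h
    -- A root of `q` with period `e < n + 1` would also be a root of `p e`, hence a multiple root of
    -- `R_{n+1}`.
    exfalso
    have hen := (h n).1 hR
    have hemem : e ∈ (n + 1).properDivisors :=
      Nat.mem_properDivisors.2 ⟨hen, lt_of_le_of_ne (Nat.le_of_dvd hn hen) hne⟩
    refine aeval_ne_zero_of_mul_hasDistinctRoots (hq ▸ hasDistinctRoots_Rpoly n) ?_ ha
    rw [map_prod]
    exact Finset.prod_eq_zero hemem (((hp e hemem).2.2 a).2 h)
  · have hR : aeval a (Rpoly (n + 1)) = 0 := (ha n).2 dvd_rfl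
    rw [hq, map_mul, map_prod] at hR
    refine (mul_eq_zero.1 hR).resolve_left (Finset.prod_ne_zero_iff.2 fun d hd h0 => ?_)
    have h := ((hp d hd).2.2 a).1 h0
    obtain ⟨hd0, hdn, -⟩ := hpd d hd
    obtain ⟨e, rfl⟩ := Nat.exists_eq_succ_of_ne_zero hd0.ne'
    exact hdn.not_ge (Nat.le_of_dvd hd0 ((ha e).1 ((h e).2 dvd_rfl)))

theorem sum_divisors_moebius_div {n : ℕ} (hn : 2 ≤ n) :
    ∑ k ∈ n.divisors, ArithmeticFunction.moebius (n / k) = 0 := by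
  have h := (ArithmeticFunction.sum_eq_iff_sum_mul_moebius_eq (R := ℤ)
    (f := fun i => if i = 1 then 1 else 0) (g := fun _ => 1)).1 (fun m hm => by
      simp [Finset.sum_ite_eq', hm.ne']) n (by omega)
  simp only [mul_one, Int.cast_id] at h
  rw [Nat.sum_divisorsAntidiagonal' fun i _ => ArithmeticFunction.moebius i, if_neg (by omega)] at h
  exact h

theorem natDegree_of_algebraMap_eq_Pfrac {n : ℕ} (hn : 2 ≤ n) {P : ℤ[X]}
    (hP : algebraMap ℤ[X] (FractionRing ℤ[X]) P = Pfrac n) :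
    (P.natDegree : ℤ) =
      2 * ∑ k ∈ n.divisors, ArithmeticFunction.moebius (n / k) * (3 : ℤ) ^ k := by
  have hinj := IsFractionRing.injective ℤ[X] (FractionRing ℤ[X])
  have : ∀ d, ∃ p : ℤ[X], 0 < d → algebraMap ℤ[X] (FractionRing ℤ[X]) p = Pfrac d := by
    intro d
    by_cases hd : 0 < d
    · obtain ⟨p, hp, -⟩ := exists_Pfrac_eq d hd
      exact ⟨p, fun _ => hp⟩
    · exact ⟨0, fun h => (hd h).elim⟩
  choose p hp using this
  have hprod : ∀ m > 0, ∏ d ∈ m.divisors, p d = Rpoly m := fun m hm => hinj <| by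
    rw [map_prod, ← prod_Pfrac hm]
    exact Finset.prod_congr rfl fun d hd => hp d (Nat.pos_of_mem_divisors hd)
  have hp0 : ∀ d, 0 < d → p d ≠ 0 := fun d hd h => by
    have := hp d hd
    rw [h, map_zero] at this
    exact Pfrac_ne_zero this.symm
  -- Möbius inversion of this identity gives the degree; the `-1` drops out because the values `μ(n
  -- / k)` sum to 0 for `n ≥ 2`.
  have hsum : ∀ m > 0, ∑ d ∈ m.divisors, ((p d).natDegree : ℤ) = 2 * 3 ^ m - 1 := by
    intro m hm
    have h := congrArg natDegree (hprod m hm)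
    rw [natDegree_prod _ _ fun d hd => hp0 d (Nat.pos_of_mem_divisors hd)] at h
    rw [← Nat.cast_sum, h]
    obtain ⟨k, rfl⟩ := Nat.exists_eq_succ_of_ne_zero hm.ne'
    rw [natDegree_Rpoly, Nat.cast_sub (Nat.one_le_iff_ne_zero.2 (by positivity))]
    push_cast
    rfl
  have h := ArithmeticFunction.sum_eq_iff_sum_mul_moebius_eq.1 hsum n (by omega)
  simp only [Int.cast_id] at h
  have hPn : P = p n := hinj (hP.trans (hp n (by omega)).symm)
  rw [hPn, ← h, Nat.sum_divisorsAntidiagonal' fun i j =>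
    ArithmeticFunction.moebius i * (2 * (3 : ℤ) ^ j - 1), Finset.mul_sum]
  simp only [mul_sub, mul_one, Finset.sum_sub_distrib, sum_divisors_moebius_div hn, sub_zero]
  exact Finset.sum_congr rfl fun k _ => by ring

theorem proposition14 (n : ℕ) (hn : 1 ≤ n) :
    HasDistinctRoots (Rpoly n) ∧
    (∃ P : ℤ[X], algebraMap ℤ[X] (FractionRing ℤ[X]) P = Pfrac n ∧
      HasDistinctRoots P ∧
      (2 ≤ n → (P.natDegree : ℤ) =
        2 * ∑ k ∈ n.divisors, ArithmeticFunction.moebius (n / k) * (3 : ℤ) ^ k)) ∧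
    (Rpoly n).map (Int.castRingHom (ZMod 3)) =
      (-1) ^ (n - 1) * (X ^ 3 ^ n - X) * (X - 1) ^ (3 ^ n - 1) ∧
    (Rpoly n).natDegree = 2 * 3 ^ n - 1 := by
  obtain ⟨P, hP, hdvd, -⟩ := exists_Pfrac_eq n hn
  obtain ⟨m, rfl⟩ := Nat.exists_eq_add_of_le' hn
  exact ⟨hasDistinctRoots_Rpoly m,
    ⟨P, hP, hasDistinctRoots_of_dvd (hasDistinctRoots_Rpoly m) hdvd,
      fun h => natDegree_of_algebraMap_eq_Pfrac h hP⟩,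
    Rpoly_map_zmod_three m, natDegree_Rpoly m⟩
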